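/- Let $m>2$, $n=2^m-1=r_1r_2$ with $\gcd(r_1,r_2)=1$, $r_1,r_2>1$, and suppose that $2$ has multiplicative order $m$ modulo $r_1$. Let $G$ be the field with $2^m$ elements, $\alpha$ a generator of $G^*=G\setminus\{0\}$, and $\varphi:\mathbb Z_n\to\mathbb Z_{r_1}\times\mathbb Z_{r_2}$ an isomorphism of additive groups. Words are $x=\sum_{g\in G}x_gX^g$ with $x_g\in\mathbb F_2$, $\omega(x)$ is the Hamming weight, and a permutation $\tau$ of $G$ acts by $\tau(x)=\sum_g x_gX^{\tau(g)}$. Let $\mathcal C=R(1,m)$ be the first-order Reed–Muller code, that is, the code of all $x$ with $\sum_g x_g g^i=0$ (where $0^0=1$) for every $0\le i<2^m-1$ whose binary expansion has fewer than $m-1$ ones. Let $d$ be its minimum distance and $t=\lfloor (d-1)/2\rfloor$ its error-correction capability. Put $$I=\{0\}\cup\{\alpha^i\mid \varphi(i)\in\Gamma\},\qquad \Gamma=\{(i_1,i_2)\in\mathbb Z_{r_1}\times\mathbb Z_{r_2}\mid 0\le i_1<m,\ i_2=0\}.$$ An *$s$-PD-like set* is a set $P$ of permutation automorphisms of the punctured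 code $\mathcal C^*$ (coordinate $0$ deleted) such that for any $s$ positions in $G^*$ some $\tau\in P$ moves all of them out of $I\setminus\{0\}$; its elements are extended to $G$ by fixing $0$. *Algorithm II* takes a parity check matrix $H$ of $\mathcal C$ in standard form with respect to $I$ (the columns at the positions outside $I$ are those of an identity matrix), an enumerated $s$-PD-like set $P$ and a received word $r$. For $\sigma=1,\sigma_0,\dots,\sigma_{n-1}$ in turn, where $\sigma_k(g)=g+\alpha^k$, and for each $\sigma$ for the $\tau\in P$ in turn, it tests whether $\omega(H\cdot\tau(\sigma(r))^T)\le t$. At the first success it finds the codeword $c'\in\mathcal C$ that agrees with $\tau(\sigma(r))$ on $I$, and it returns $\sigma^{-1}(\tau^{-1}(c'))$. Then $\lambda_0=\max\{\lambda\ge 1\mid m<\lceil r_1/\lambda\rceil\}$ exists. Put $s=(\lambda_0+1)\,r_2-1$. The set $I$ is an information set for $\mathcal C$; a parity check matrix in standard form with respect to $I$ and an $s$-PD-like set exist; and, for every choice of these, Algorithm II applied to $c+e$ returns $c$ for every $c\in\mathcal C$ and every error vector $e$ with $\omega(e)\le s$ and $\omega(e)\le t$. Moreover $s\le t$ whenever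 $m\ne4$, so that Algorithm II corrects up to $s$ errors in $R(1,m)$ for every such $m$. -/

import Mathlib

namespace PermDec

/-- Words with binary coefficients at the positions `ι`. For `ι = K` this is the vector space
underlying the group algebra of the additive group of `K`: `x g` is the coefficient of `X ^ g`. -/
abbrev Word (ι : Type*) := ι → ZMod 2

/-- The action of a permutation of the positions: the coefficient at `i` is moved to `τ i`. -/
def act {ι : Type*} (τ : Equiv.Perm ι) (x : Word ι) : Word ι := fun i => x (τ.symm i)

/-- The permutation automorphisms of a code. -/
def PAut {ι : Type*} (C : Submodule (ZMod 2) (Word ι)) : Set (Equiv.Perm ι) :=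
  {τ | act τ '' (C : Set (Word ι)) = C}

/-- The minimum distance of a linear code. -/
noncomputable def minDist {ι : Type*} [Fintype ι] (C : Submodule (ZMod 2) (Word ι)) : ℕ :=
  sInf {d | ∃ x ∈ C, x ≠ 0 ∧ hammingNorm x = d}

/-- The error-correction capability `⌊(d - 1) / 2⌋` of a linear code. -/
noncomputable def capability {ι : Type*} [Fintype ι] (C : Submodule (ZMod 2) (Word ι)) : ℕ :=
  (minDist C - 1) / 2

/-- `I` is an information set for `C`: `|I| = dim C`, and the codewords project onto all the
assignments of symbols to the positions of `I`. -/
def IsInformationSet {ι : Type*} (C : Submodule (ZMod 2) (Word ι)) (I : Set ι) : Prop :=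
  I.ncard = Module.finrank (ZMod 2) C ∧ ∀ v : I → ZMod 2, ∃ c ∈ C, ∀ i : I, c i = v i

/-- The dual code. -/
def dualCode {ι : Type*} [Fintype ι] (C : Submodule (ZMod 2) (Word ι)) :
    Submodule (ZMod 2) (Word ι) where
  carrier := {y | ∀ x ∈ C, y ⬝ᵥ x = 0}
  add_mem' ha hb x hx := by rw [add_dotProduct, ha x hx, hb x hx, add_zero]
  zero_mem' x _ := zero_dotProduct x
  smul_mem' a y hy x hx := by rw [smul_dotProduct, hy x hx, smul_zero]

/-- `H` is a parity check matrix for `C` (its rows form a basis of the dual code) in standard form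
with respect to `I` (the columns at the positions outside `I` are those of the identity matrix). -/
structure IsStandardParityCheck {ι ρ : Type*} [Fintype ι] [DecidableEq ρ]
    (C : Submodule (ZMod 2) (Word ι)) (I : Set ι) (H : Matrix ρ ι (ZMod 2)) : Prop where
  linearIndependent : LinearIndependent (ZMod 2) (fun i : ρ => H i)
  span_rows : Submodule.span (ZMod 2) (Set.range fun i : ρ => H i) = dualCode C
  standard : ∃ e : {g : ι // g ∉ I} ≃ ρ, ∀ (i : ρ) (g : {g : ι // g ∉ I}),
    H i g = if i = e g then 1 else 0

section Field

variable {K : Type*} [Field K]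

/-- The nonzero positions `G* = G \ {0}`. -/
abbrev NonzeroPos (K : Type*) [Field K] := {g : K // g ≠ 0}

/-- The code punctured at the position `0`. -/
def punctured (C : Submodule (ZMod 2) (Word K)) : Submodule (ZMod 2) (Word (NonzeroPos K)) :=
  C.map (LinearMap.funLeft (ZMod 2) (ZMod 2) (Subtype.val : NonzeroPos K → K))

/-- `P` is an `s`-PD-like set for the punctured code of `C` with respect to `I' = I \ {0}`:
it consists of permutation automorphisms of the punctured code, and any `s` positions in `G*` are
moved out of `I'` by at least one element of `P`. -/
def IsPDLikeSet (C : Submodule (ZMod 2) (Word K)) (I : Set K) (s : ℕ)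
    (P : Set (Equiv.Perm (NonzeroPos K))) : Prop :=
  P ⊆ PAut (punctured C) ∧
    ∀ B : Finset (NonzeroPos K), B.card = s → ∃ τ ∈ P, ∀ b ∈ B, (τ b : K) ∉ I

/-- The ordered list `1, σ_0, …, σ_{n-1}`, `n = |K| - 1`, where `σ_k` is the translation
`g ↦ g + α ^ k`. -/
def translations [Fintype K] (α : K) : List (Equiv.Perm K) :=
  1 :: (List.range (Fintype.card K - 1)).map fun k => Equiv.addRight (α ^ k)

/-- The codeword of `C` that has the same symbols as `v` at the positions of `I`
(there is exactly one when `I` is an information set for `C`). -/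
noncomputable def recover (C : Submodule (ZMod 2) (Word K)) (I : Set K) (v : Word K) : Word K :=
  Classical.epsilon fun c => c ∈ C ∧ ∀ i ∈ I, c i = v i

/-- Algorithm II. For `σ` running through `1, σ_0, …, σ_{n-1}` and, for each `σ`, for `τ` running
through `P` (a permutation of the nonzero positions, extended so as to fix `0`), the weight of the
syndrome of `τ (σ r)` is compared with `t`, the correction capability of `C`. At the first pair for
which it is at most `t`, the codeword `c'` with the information symbols of `τ (σ r)` is recovered,
and the output is `c'` with `τ` and `σ` undone. If there is no such pair, the output is `none`. -/
noncomputable def algorithmII [Fintype K] [DecidableEq K] {ρ : Type*} [Fintype ρ]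
    (C : Submodule (ZMod 2) (Word K)) (α : K) (I : Set K) (H : Matrix ρ K (ZMod 2))
    (P : List (Equiv.Perm (NonzeroPos K))) (r : Word K) : Option (Word K) :=
  (translations α).findSome? fun σ =>
    P.findSome? fun τ =>
      let τ' : Equiv.Perm K := Equiv.Perm.ofSubtype τ
      if hammingNorm (H.mulVec (act τ' (act σ r))) ≤ capability C then
        some (act σ⁻¹ (act τ'⁻¹ (recover C I (act τ' (act σ r)))))
      else none

/-- The 2-weight of a natural number. -/
def twoWeight (k : ℕ) : ℕ := (Nat.digits 2 k).sum

/-- The map `φ_s : 𝔽G → G`, `∑ x_g X ^ g ↦ ∑ x_g g ^ s`, with `0 ^ 0 = 1`. -/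
def phi [Fintype K] [Algebra (ZMod 2) K] (s : ℕ) : Word K →ₗ[ZMod 2] K where
  toFun x := ∑ g : K, x g • g ^ s
  map_add' x y := by simp [add_smul, Finset.sum_add_distrib]
  map_smul' a x := by simp [Finset.smul_sum, mul_smul]

/-- The Reed-Muller code `R(ρ, m)` of order `ρ` and length `2 ^ m = |K|`: the code with defining
set `{i | 0 ≤ i < 2 ^ m - 1, wt(i) < m - ρ}`. -/
def reedMuller (K : Type*) [Field K] [Fintype K] [Algebra (ZMod 2) K] (ρ m : ℕ) :
    Submodule (ZMod 2) (Word K) :=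
  ⨅ i ∈ {i : ℕ | i < 2 ^ m - 1 ∧ twoWeight i < m - ρ}, LinearMap.ker (phi (K := K) i)

/-- The set `Γ` of the `(i₁, i₂)` with `0 ≤ i₁ < a` and `0 ≤ i₂ < m / a`, where `a` is the
multiplicative order of `2` modulo `r₁`. -/
def Gam (m r₁ r₂ : ℕ) : Set (ZMod r₁ × ZMod r₂) :=
  {p | p.1.val < orderOf (2 : ZMod r₁) ∧ p.2.val < m / orderOf (2 : ZMod r₁)}

/-- The set of positions `{0} ∪ {α ^ i | φ i ∈ Γ}`. -/
def infoSet (m : ℕ) {n r₁ r₂ : ℕ} (α : K) (φ : ZMod n ≃+ ZMod r₁ × ZMod r₂) : Set K :=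
  {0} ∪ {g | ∃ i : ZMod n, φ i ∈ Gam m r₁ r₂ ∧ g = α ^ i.val}

end Field

end PermDec

/-! Everything rests on `mem_reedMuller_one_iff`: the code consists of the affine functions on `K`.
If `x` is in the code, each difference `x (g + h) - x g` is orthogonal to all powers below `2 ^ m -
1`: in the binomial expansion the top term cancels and every other odd coefficient lowers the
2-weight. Such a difference is constant, so `x` is affine. Conversely, a functional is a trace form,
a combination of the `g ^ 2 ^ k`, and the resulting power sums vanish.

Affine functions give `d = 2 ^ (m - 1)`, even weights, and invariance under translations and
scalings. The field element with logarithm `(1, 0)` has order `r₁`; since `2` has order `m` modulo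
`r₁`, its first `m` powers are a basis of `K`, and with `0` they form an information set.

On logarithms, scaling is translation of `ZMod r₁ × ZMod r₂`. By pigeonhole, fewer than `(λ₀ + 1)
r₂` points leave some row with at most `λ₀` of them, and `λ₀ m < r₁` leaves a shift taking that row
off the segment (`exists_shift_notMem_segment`).

For the decoder (`algorithmII_eq_some`), any passing test yields the right codeword, and some test
passes: a translation puts an error-free position at `0`, then `P` clears the rest of `I`. -/

namespace PermDec

/-! ### 2-weights of exponents -/

section TwoWeight

lemma twoWeight_bit (q b : ℕ) (hb : b < 2) : twoWeight (2 * q + b) = twoWeight q + b := by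
  unfold twoWeight
  by_cases h : 2 * q + b = 0
  · obtain rfl : q = 0 := by omega
    obtain rfl : b = 0 := by omega
    simp
  · rw [Nat.digits_def' (by norm_num) (by omega)]
    have h1 : (2 * q + b) % 2 = b := by omega
    have h2 : (2 * q + b) / 2 = q := by omega
    rw [h1, h2, List.sum_cons, add_comm]

lemma twoWeight_le (m i : ℕ) (hi : i < 2 ^ m) : twoWeight i ≤ m := by
  induction m generalizing i with
  | zero => obtain rfl : i = 0 := by simpa using hi
            simp [twoWeight]
  | succ m ih =>
    have h := twoWeight_bit (i / 2) (i % 2) (Nat.mod_lt _ (by norm_num))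
    rw [Nat.div_add_mod] at h
    have := ih (i / 2) (by rw [pow_succ] at hi; omega)
    omega

lemma twoWeight_lt (m i : ℕ) (hi : i < 2 ^ m - 1) : twoWeight i < m := by
  induction m generalizing i with
  | zero => simp at hi
  | succ m ih =>
    have h := twoWeight_bit (i / 2) (i % 2) (Nat.mod_lt _ (by norm_num))
    rw [Nat.div_add_mod] at h
    rw [pow_succ] at hi
    rcases Nat.mod_two_eq_zero_or_one i with h0 | h1
    · have := twoWeight_le m (i / 2) (by omega)
      omega
    · have := ih (i / 2) (by omega)
      omega

lemma twoWeight_two_pow_sub_one (m : ℕ) : twoWeight (2 ^ m - 1) = m := by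
  induction m with
  | zero => simp [twoWeight]
  | succ m ih =>
    have h := twoWeight_bit (2 ^ m - 1) 1 (by norm_num)
    have h2 : 2 * (2 ^ m - 1) + 1 = 2 ^ (m + 1) - 1 := by
      have := Nat.one_le_two_pow (n := m)
      rw [pow_succ]; omega
    rw [h2, ih] at h
    exact h

/-- Removing one binary digit from `2 ^ m - 1` leaves `m - 1` of them. -/
lemma le_twoWeight_add_one (m i k : ℕ) (h : 2 ^ k + i = 2 ^ m - 1) : m ≤ twoWeight i + 1 := by
  induction k generalizing m i with
  | zero =>
    cases m with
    | zero => omega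
    | succ m =>
      have h1 := Nat.one_le_two_pow (n := m)
      have h2 : i = 2 * (2 ^ m - 1) + 0 := by rw [pow_succ] at h; omega
      have h3 := twoWeight_bit (2 ^ m - 1) 0 (by norm_num)
      rw [← h2, twoWeight_two_pow_sub_one] at h3
      omega
  | succ k ih =>
    cases m with
    | zero => omega
    | succ m =>
      have h1 := Nat.one_le_two_pow (n := m)
      have h4 := Nat.one_le_two_pow (n := k)
      have h2 : i = 2 * (i / 2) + 1 := by rw [pow_succ, pow_succ] at h; omega
      have h3 := twoWeight_bit (i / 2) 1 (by norm_num)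
      rw [← h2] at h3
      have := ih m (i / 2) (by rw [pow_succ, pow_succ] at h; omega)
      omega

/-- Kummer: the exponents of the nonleading odd binomial coefficients have smaller 2-weight. -/
lemma twoWeight_lt_of_odd_choose {i j : ℕ} (hj : j < i) (h : ¬ 2 ∣ i.choose j) :
    twoWeight j < twoWeight i := by
  have : Fact (Nat.Prime 2) := ⟨Nat.prime_two⟩
  have h1 := sub_one_mul_padicValNat_choose_eq_sub_sum_digits (p := 2) hj.le
  rw [padicValNat.eq_zero_of_not_dvd h, mul_zero] at h1
  -- Valuation zero leaves wt(j) + wt(i - j) ≤ wt(i), so strictness only needs a nonzero digit in `i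
  -- - j`.
  have h2 : 0 < (Nat.digits 2 (i - j)).sum := by
    by_contra h0
    have h3 : (Nat.digits 2 (i - j)).sum = 0 := by omega
    have h4 := Nat.modEq_digits_sum 2 3 (by norm_num) (i - j)
    have h5 : ∀ d ∈ Nat.digits 2 (i - j), d = 0 := List.sum_eq_zero_iff.1 h3
    have h6 : Nat.digits 2 (i - j) ≠ [] := Nat.digits_ne_nil_iff_ne_zero.2 (by omega)
    exact Nat.getLast_digit_ne_zero 2 (m := i - j) (by omega) (h5 _ (List.getLast_mem h6))
  unfold twoWeight
  omega

end TwoWeight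

/-! ### R(1, m) as the code of affine functions -/

section Affine

/-- Some unit `u` has `u ^ i ≠ 1`, and the substitution `g ↦ u g` multiplies the sum by `u ^ i`. -/
lemma sum_pow_eq_zero_of_not_dvd {K : Type*} [Field K] [Fintype K] {i : ℕ}
    (hi : ¬ Fintype.card K - 1 ∣ i) : ∑ g : K, g ^ i = 0 := by
  rw [← FiniteField.forall_pow_eq_one_iff] at hi
  push Not at hi
  obtain ⟨u, hu⟩ := hi
  have h : ∑ g : K, g ^ i = (u : K) ^ i * ∑ g : K, g ^ i := by
    rw [Finset.mul_sum]
    exact (Fintype.sum_equiv (Equiv.mulLeft₀ (u : K) u.ne_zero) _ _ fun g => by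
      simp [mul_pow]).symm
  have h2 : ((u : K) ^ i - 1) * ∑ g : K, g ^ i = 0 := by rw [sub_mul, ← h, one_mul, sub_self]
  refine (mul_eq_zero.1 h2).resolve_left fun h3 => hu ?_
  ext
  simpa using sub_eq_zero.1 h3

variable {K : Type*} [Field K] [Fintype K] [Algebra (ZMod 2) K]

lemma mem_reedMuller_one {m : ℕ} {x : Word K} :
    x ∈ reedMuller K 1 m ↔
      ∀ i, i < 2 ^ m - 1 → twoWeight i < m - 1 → ∑ g : K, x g • g ^ i = 0 := by
  simp only [reedMuller, Submodule.mem_iInf, Set.mem_ofPred_eq, LinearMap.mem_ker, phi]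
  exact ⟨fun h i h1 h2 => h i ⟨h1, h2⟩, fun h i hi => h i hi.1 hi.2⟩

lemma charP_two (K : Type*) [Field K] [Algebra (ZMod 2) K] : CharP K 2 :=
  charP_of_injective_algebraMap (algebraMap (ZMod 2) K).injective 2

/-- The differences of a word of `R(1, m)` are orthogonal to all powers below the last one. -/
lemma sum_difference_smul_pow {m : ℕ} {x : Word K} (hx : x ∈ reedMuller K 1 m) (h : K) {i : ℕ}
    (hi : i < 2 ^ m - 1) : ∑ g : K, (x (g + h) - x g) • g ^ i = 0 := by
  have := charP_two K
  rw [mem_reedMuller_one] at hx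
  have h1 : ∑ g : K, x (g + h) • g ^ i = ∑ g : K, x g • (g + -h) ^ i :=
    Fintype.sum_equiv (Equiv.addRight h) _ _ fun g => by simp
  simp only [sub_smul, Finset.sum_sub_distrib]
  rw [h1]
  simp only [add_pow, Finset.sum_range_succ, smul_add, Finset.sum_add_distrib, Nat.sub_self,
    pow_zero, mul_one, Nat.choose_self, Nat.cast_one, add_sub_cancel_right, Finset.smul_sum]
  rw [Finset.sum_comm]
  refine Finset.sum_eq_zero fun j hj => ?_
  rw [Finset.mem_range] at hj
  by_cases hodd : 2 ∣ i.choose j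
  · simp [(CharP.cast_eq_zero_iff K 2 _).2 hodd]
  -- wt(j) < wt(i) < m, so wt(j) < m - 1 and `j` lies in the defining set.
  · have hw := twoWeight_lt_of_odd_choose hj hodd
    have hi' := twoWeight_lt m i hi
    have h2 := hx j (by omega) (by omega)
    simp only [mul_assoc, ← smul_mul_assoc]
    rw [← Finset.sum_mul, h2, zero_mul]

/-- A word orthogonal to all polynomials of degree below `|K| - 1` is constant. -/
lemma eq_of_sum_smul_pow_eq_zero {x : Word K}
    (hx : ∀ i < Fintype.card K - 1, ∑ g : K, x g • g ^ i = 0) (a b : K) : x a = x b := by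
  classical
  have hn : 0 < Fintype.card K - 1 := by have := Fintype.one_lt_card (α := K); omega
  have key : ∀ p : Polynomial K, p.degree < ((Fintype.card K - 1 : ℕ) : WithBot ℕ) →
      ∑ g : K, x g • p.eval g = 0 := by
    intro p hp
    have hp' : p.natDegree < Fintype.card K - 1 := by
      rcases eq_or_ne p 0 with rfl | h0
      · simpa using hn
      · exact (Polynomial.natDegree_lt_iff_degree_lt h0).2 hp
    simp only [Polynomial.eval_eq_sum_range' hp', Finset.smul_sum]
    rw [Finset.sum_comm]
    refine Finset.sum_eq_zero fun i hi => ?_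
    have := hx i (Finset.mem_range.1 hi)
    simp only [← mul_smul_comm]
    rw [← Finset.mul_sum, this, mul_zero]
  -- `(g - c) ^ (|K| - 1)` is 1 minus the indicator of `c`. For two values of `c` the leading terms
  -- cancel, so orthogonality applies to the difference and compares `x a` with `x b`.
  have hmon : ∀ c : K, ((Polynomial.X - Polynomial.C c) ^ (Fintype.card K - 1)).Monic :=
    fun c => (Polynomial.monic_X_sub_C c).pow _
  have hdeg : ∀ c : K, ((Polynomial.X - Polynomial.C c) ^ (Fintype.card K - 1)).degree
      = ((Fintype.card K - 1 : ℕ) : WithBot ℕ) := by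
    intro c; rw [Polynomial.degree_pow, Polynomial.degree_X_sub_C]; simp
  have h := key ((Polynomial.X - Polynomial.C a) ^ (Fintype.card K - 1)
      - (Polynomial.X - Polynomial.C b) ^ (Fintype.card K - 1)) (by
    rw [← hdeg a]
    exact Polynomial.degree_sub_lt_left ((hdeg a).trans (hdeg b).symm) (hmon a).ne_zero
      ((hmon a).trans (hmon b).symm))
  have hev : ∀ c g : K, ((Polynomial.X - Polynomial.C c) ^ (Fintype.card K - 1)).eval g
      = 1 - if g = c then 1 else 0 := by
    intro c g
    by_cases hg : g = c
    · simp [hg, hn.ne']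
    · simp [hg, FiniteField.pow_card_sub_one_eq_one _ (sub_ne_zero.2 hg)]
  simp only [Polynomial.eval_sub, hev, sub_sub_sub_cancel_left, Algebra.smul_def, mul_sub, mul_ite,
    mul_one, mul_zero, Finset.sum_sub_distrib, Finset.sum_ite_eq', Finset.mem_univ, if_true] at h
  exact ((algebraMap (ZMod 2) K).injective (sub_eq_zero.1 h)).symm

lemma linear_mem_reedMuller {m : ℕ} (hm : 2 ≤ m) (hK : Fintype.card K = 2 ^ m)
    (L : K →ₗ[ZMod 2] ZMod 2) : (fun g => L g) ∈ reedMuller K 1 m := by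
  have hnd := traceForm_nondegenerate (ZMod 2) K
  obtain ⟨a, ha⟩ : ∃ a : K, ∀ g, L g = Algebra.trace (ZMod 2) K (a * g) :=
    ⟨((Algebra.traceForm (ZMod 2) K).toDual hnd).symm L, fun g => by
      rw [← Algebra.traceForm_apply, LinearMap.BilinForm.apply_toDual_symm_apply]⟩
  have hrank : Module.finrank (ZMod 2) K = m := by
    have := Module.card_eq_pow_finrank (K := ZMod 2) (V := K)
    rw [hK, ZMod.card] at this
    exact (Nat.pow_right_injective le_rfl this).symm
  rw [mem_reedMuller_one]
  intro i hi hw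
  simp only [Algebra.smul_def, ha, FiniteField.algebraMap_trace_eq_sum_pow, Finset.sum_mul]
  rw [Finset.sum_comm]
  refine Finset.sum_eq_zero fun k hk => ?_
  rw [hrank, Finset.mem_range] at hk
  simp only [mul_pow, mul_assoc, ← pow_add, Nat.card_zmod]
  rw [← Finset.mul_sum, sum_pow_eq_zero_of_not_dvd, mul_zero]
  rintro ⟨q, hq⟩
  rw [hK] at hq
  have h1 : 2 ^ k * 2 ≤ 2 ^ m := by
    rw [← pow_succ]; exact Nat.pow_le_pow_right (by norm_num) hk
  have h2 : 2 ^ 2 ≤ 2 ^ m := Nat.pow_le_pow_right (by norm_num) hm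
  have h3 := Nat.one_le_two_pow (n := k)
  -- `2 ^ k + i` lies strictly between 0 and `2 (2 ^ m - 1)`.
  have hq1 : q = 1 := by
    have hlt : q < 2 := by
      by_contra hge
      have : (2 ^ m - 1) * 2 ≤ (2 ^ m - 1) * q := Nat.mul_le_mul_left _ (by omega)
      omega
    have : q ≠ 0 := by rintro rfl; omega
    omega
  rw [hq1, mul_one] at hq
  have := le_twoWeight_add_one m i k hq
  omega

/-- `R(1, m)` consists of the affine functions. -/
theorem mem_reedMuller_one_iff {m : ℕ} (hm : 2 ≤ m) (hK : Fintype.card K = 2 ^ m) {x : Word K} :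
    x ∈ reedMuller K 1 m ↔ ∃ (L : K →ₗ[ZMod 2] ZMod 2) (b : ZMod 2), ∀ g, x g = L g + b := by
  constructor
  · intro hx
    have hD : ∀ h a : K, x (a + h) - x a = x h - x 0 := by
      intro h a
      have := eq_of_sum_smul_pow_eq_zero (x := fun g => x (g + h) - x g)
        (fun i hi => sum_difference_smul_pow hx h (by rwa [hK] at hi)) a 0
      simpa using this
    let f : K →+ ZMod 2 := AddMonoidHom.mk' (fun g => x g - x 0) fun a h => by
      linear_combination hD h a
    exact ⟨f.toZModLinearMap 2, x 0, fun g => by simp [f]⟩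
  · rintro ⟨L, b, h⟩
    have hc : (fun _ : K => b) ∈ reedMuller K 1 m := by
      rw [mem_reedMuller_one]
      intro i hi _
      rw [← Finset.smul_sum, FiniteField.sum_pow_lt_card_sub_one K i (by rwa [hK]), smul_zero]
    have : x = (fun g => L g) + fun _ => b := funext h
    rw [this]
    exact add_mem (linear_mem_reedMuller hm hK L) hc

end Affine

end PermDec

namespace PermDec

/-! ### Permutations acting on words -/

section Act

variable {ι : Type*}

lemma act_add (τ : Equiv.Perm ι) (x y : Word ι) : act τ (x + y) = act τ x + act τ y := rfl

lemma act_inv_act (τ : Equiv.Perm ι) (x : Word ι) : act τ⁻¹ (act τ x) = x :=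
  funext fun i => congrArg x (τ.symm_apply_apply i)

lemma act_act_inv (τ : Equiv.Perm ι) (x : Word ι) : act τ (act τ⁻¹ x) = x :=
  funext fun i => congrArg x (τ.apply_symm_apply i)

lemma hammingNorm_act [Fintype ι] (τ : Equiv.Perm ι) (x : Word ι) :
    hammingNorm (act τ x) = hammingNorm x := by
  unfold hammingNorm act
  refine Finset.card_bij' (fun i _ => τ.symm i) (fun i _ => τ i) ?_ ?_ ?_ ?_ <;> simp

lemma mem_PAut_of_mapsTo {C : Submodule (ZMod 2) (Word ι)} {τ : Equiv.Perm ι}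
    (h : ∀ x ∈ C, act τ x ∈ C) (h' : ∀ x ∈ C, act τ⁻¹ x ∈ C) : τ ∈ PAut C := by
  refine Set.Subset.antisymm ?_ fun x hx => ⟨act τ⁻¹ x, h' x hx, act_act_inv τ x⟩
  rintro _ ⟨x, hx, rfl⟩
  exact h x hx

end Act

/-! ### Information sets, standard parity checks and unique decoding -/

section InformationSet

variable {ι : Type*} [Fintype ι] {C : Submodule (ZMod 2) (Word ι)} {I : Set ι}

/-- Restriction to `I` is a surjection between spaces of equal dimension, hence injective on the
code. -/
lemma IsInformationSet.eq_of_agree (hI : IsInformationSet C I) {c c' : Word ι} (hc : c ∈ C)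
    (hc' : c' ∈ C) (h : ∀ i ∈ I, c i = c' i) : c = c' := by
  classical
  let f : C →ₗ[ZMod 2] (I → ZMod 2) :=
    (LinearMap.funLeft (ZMod 2) (ZMod 2) (Subtype.val : I → ι)).comp C.subtype
  have hs : Function.Surjective f := fun v => by
    obtain ⟨c, hc, hv⟩ := hI.2 v
    exact ⟨⟨c, hc⟩, funext fun i => hv i⟩
  have hd : Module.finrank (ZMod 2) C = Module.finrank (ZMod 2) (I → ZMod 2) := by
    rw [Module.finrank_fintype_fun_eq_card, ← hI.1, Set.ncard_eq_toFinset_card', Set.toFinset_card]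
  have hinj := (LinearMap.injective_iff_surjective_of_finrank_eq_finrank hd).2 hs
  have := @hinj ⟨c, hc⟩ ⟨c', hc'⟩ (funext fun i => h i i.2)
  exact congrArg Subtype.val this

lemma IsStandardParityCheck.mulVec_eq_zero {ρ : Type*} [DecidableEq ρ] {H : Matrix ρ ι (ZMod 2)}
    (hH : IsStandardParityCheck C I H) {c : Word ι} (hc : c ∈ C) : H.mulVec c = 0 := by
  funext r
  have : H r ∈ dualCode C := by
    rw [← hH.span_rows]; exact Submodule.subset_span ⟨r, rfl⟩
  exact this c hc

/-- Only the identity columns contribute, so the syndrome is `y` outside `I`, relabelled. -/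
lemma IsStandardParityCheck.hammingNorm_mulVec {ρ : Type*} [Fintype ρ] [DecidableEq ρ]
    {H : Matrix ρ ι (ZMod 2)} (hH : IsStandardParityCheck C I H) {y : Word ι}
    (hy : ∀ i ∈ I, y i = 0) : hammingNorm (H.mulVec y) = hammingNorm y := by
  classical
  obtain ⟨e, he⟩ := hH.standard
  have key : ∀ g, H.mulVec y (e g) = y g := by
    intro g
    rw [Matrix.mulVec, dotProduct, Fintype.sum_eq_single g.1]
    · rw [he]; simp
    · intro x hx
      by_cases hxI : x ∈ I
      · rw [hy x hxI, mul_zero]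
      · rw [he (e g) ⟨x, hxI⟩, if_neg, zero_mul]
        exact fun h => hx (congrArg Subtype.val (e.injective h)).symm
  unfold hammingNorm
  symm
  refine Finset.card_bij (fun g hg => e ⟨g, fun h => (Finset.mem_filter.1 hg).2 (hy g h)⟩)
    ?_ ?_ ?_
  · intro g hg
    simpa [key] using hg
  · intro a ha b hb h
    exact congrArg Subtype.val (e.injective h)
  · intro r hr
    refine ⟨(e.symm r).1, ?_, by simp⟩
    have := key (e.symm r)
    rw [e.apply_symm_apply] at this
    simpa [← this] using hr

/-- Let `w i` be the codeword that is the `i`-th unit vector on `I`. Each codeword is the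
combination of the `w i` with its own information symbols; the rows of `H` express this for the
symbols outside `I`. -/
lemma exists_isStandardParityCheck (hI : IsInformationSet C I) :
    ∃ H : Matrix (Fin (Fintype.card ι - Module.finrank (ZMod 2) C)) ι (ZMod 2),
      IsStandardParityCheck C I H := by
  classical
  have hcard : Fintype.card {g : ι // g ∉ I} = Fintype.card ι - Module.finrank (ZMod 2) C := by
    rw [← hI.1, Set.ncard_eq_toFinset_card', Set.toFinset_card]
    exact Fintype.card_subtype_compl fun g => g ∈ I
  let e : {g : ι // g ∉ I} ≃ Fin (Fintype.card ι - Module.finrank (ZMod 2) C) :=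
    Fintype.equivFinOfCardEq hcard
  choose w hwC hw using fun i : {g : ι // g ∈ I} => hI.2 (fun j : I => if j = i then 1 else 0)
  have hexp : ∀ x ∈ C, ∀ h, ∑ i : {g : ι // g ∈ I}, w i h * x i = x h := by
    intro x hx h
    have : ∑ i : {g : ι // g ∈ I}, x i • w i = x := by
      refine hI.eq_of_agree (sum_mem fun i _ => C.smul_mem _ (hwC i)) hx fun j hj => ?_
      rw [Finset.sum_apply, Fintype.sum_eq_single ⟨j, hj⟩]
      · rw [Pi.smul_apply, hw ⟨j, hj⟩ ⟨j, hj⟩]; simp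
      · intro i hi
        rw [Pi.smul_apply, hw i ⟨j, hj⟩, if_neg hi.symm, smul_zero]
    conv_rhs => rw [← this]
    simp [Finset.sum_apply, mul_comm]
  let H : Matrix (Fin (Fintype.card ι - Module.finrank (ZMod 2) C)) ι (ZMod 2) := fun r g =>
    if hg : g ∈ I then w ⟨g, hg⟩ (e.symm r) else if r = e ⟨g, hg⟩ then 1 else 0
  have hin : ∀ r (g : {g : ι // g ∈ I}), H r g = w g (e.symm r) := fun r g => by
    simp [H, g.2]
  have hout : ∀ r (g : {g : ι // g ∉ I}), H r g = if r = e g then 1 else 0 := fun r g => by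
    simp [H, g.2]
  have hdot : ∀ r x, H r ⬝ᵥ x = ∑ i : {g : ι // g ∈ I}, w i (e.symm r) * x i + x (e.symm r) := by
    intro r x
    rw [dotProduct, ← Fintype.sum_subtype_add_sum_subtype (fun g => g ∈ I)]
    congr 1
    · simp only [hin]
    · simp only [hout]
      rw [Fintype.sum_eq_single (e.symm r)]
      · simp
      · intro g hg
        rw [if_neg, zero_mul]
        rintro rfl
        simp at hg
  have hdual : ∀ r, H r ∈ dualCode C := fun r x hx => by
    rw [hdot, hexp x hx, CharTwo.add_self_eq_zero]
  refine ⟨H, ?_, le_antisymm ?_ ?_, e, hout⟩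
  · rw [Fintype.linearIndependent_iff]
    intro a ha r
    have := congrFun ha (e.symm r)
    simpa [Finset.sum_apply, hout] using this
  · rw [Submodule.span_le]
    rintro _ ⟨r, rfl⟩
    exact hdual r
  · intro y hy
    -- After its symbols outside `I` are cleared, a dual word must vanish: pairing it with `w g`
    -- reads off its symbol at `g ∈ I`.
    have hz : y - ∑ r, y (e.symm r) • H r ∈ dualCode C :=
      sub_mem hy (sum_mem fun r _ => (dualCode C).smul_mem _ (hdual r))
    have hzout : ∀ g : {g : ι // g ∉ I}, (y - ∑ r, y (e.symm r) • H r) g = 0 := by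
      intro g
      simp [Finset.sum_apply, hout]
    have hz0 : y - ∑ r, y (e.symm r) • H r = 0 := by
      generalize y - ∑ r, y (e.symm r) • H r = z at hz hzout
      funext g
      by_cases hg : g ∈ I
      · have h := hz (w ⟨g, hg⟩) (hwC _)
        rw [dotProduct, Fintype.sum_eq_single g] at h
        · rw [hw ⟨g, hg⟩ ⟨g, hg⟩] at h
          simpa using h
        · intro x hx
          by_cases hxI : x ∈ I
          · rw [hw ⟨g, hg⟩ ⟨x, hxI⟩, if_neg, mul_zero]
            exact fun h => hx (congrArg Subtype.val h)
          · rw [hzout ⟨x, hxI⟩, zero_mul]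
      · exact hzout ⟨g, hg⟩
    rw [sub_eq_zero.1 hz0]
    exact sum_mem fun r _ => Submodule.smul_mem _ _ (Submodule.subset_span ⟨r, rfl⟩)

/-- Two codewords within the correction capability of the same word are equal. -/
lemma eq_of_hammingNorm_sub_le_capability {c c' y : Word ι} (hc : c ∈ C) (hc' : c' ∈ C)
    (h : hammingNorm (y - c) ≤ capability C) (h' : hammingNorm (y - c') ≤ capability C) :
    c = c' := by
  by_contra hne
  have hmem : minDist C ∈ {d | ∃ x ∈ C, x ≠ 0 ∧ hammingNorm x = d} :=
    Nat.sInf_mem ⟨_, c - c', sub_mem hc hc', sub_ne_zero.2 hne, rfl⟩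
  obtain ⟨x, -, hx0, hx⟩ := hmem
  -- Needed because `2 * ((d - 1) / 2) < d` fails for `d = 0` in ℕ.
  have hpos : 0 < minDist C := hx ▸ hammingNorm_pos_iff.2 hx0
  have hle : minDist C ≤ hammingNorm (c - c') :=
    Nat.sInf_le ⟨c - c', sub_mem hc hc', sub_ne_zero.2 hne, rfl⟩
  have htri := hammingDist_triangle c y c'
  rw [hammingDist_comm c c', hammingDist_comm y c', hammingDist_eq_hammingNorm,
    hammingDist_eq_hammingNorm, hammingDist_eq_hammingNorm, neg_add_eq_sub, neg_add_eq_sub,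
    neg_add_eq_sub] at htri
  unfold capability at h h'
  omega

lemma IsStandardParityCheck.hammingNorm_mulVec_le {ρ : Type*} [Fintype ρ] [DecidableEq ρ]
    {H : Matrix ρ ι (ZMod 2)} (hH : IsStandardParityCheck C I H) {c e : Word ι} {t : ℕ}
    (hc : c ∈ C) (he : hammingNorm e ≤ t) (h0 : ∀ i ∈ I, e i = 0) :
    hammingNorm (H.mulVec (c + e)) ≤ t := by
  rwa [Matrix.mulVec_add, hH.mulVec_eq_zero hc, zero_add, hH.hammingNorm_mulVec h0]

end InformationSet

/-! ### Correctness of Algorithm II -/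

section Algorithm

lemma recover_eq {K : Type*} [Fintype K] {C : Submodule (ZMod 2) (Word K)} {I : Set K}
    (hI : IsInformationSet C I) {c v : Word K} (hc : c ∈ C)
    (h : ∀ i ∈ I, c i = v i) : recover C I v = c := by
  have hs := Classical.epsilon_spec (p := fun c => c ∈ C ∧ ∀ i ∈ I, c i = v i) ⟨c, hc, h⟩
  exact hI.eq_of_agree hs.1 hc fun i hi => (hs.2 i hi).trans (h i hi).symm

/-- If the syndrome is light, then the information symbols are correct. -/
lemma recover_eq_of_hammingNorm_mulVec_le {K ρ : Type*} [Fintype K] [Fintype ρ] [DecidableEq ρ]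
    {C : Submodule (ZMod 2) (Word K)} {I : Set K} {H : Matrix ρ K (ZMod 2)}
    (hI : IsInformationSet C I) (hH : IsStandardParityCheck C I H)
    {c e : Word K} (hc : c ∈ C) (he : hammingNorm e ≤ capability C)
    (h : hammingNorm (H.mulVec (c + e)) ≤ capability C) : recover C I (c + e) = c := by
  obtain ⟨c', hc', hv⟩ := hI.2 fun i => (c + e) i
  have hv' : ∀ i ∈ I, c' i = (c + e) i := fun i hi => hv ⟨i, hi⟩
  -- `c + e - c'` vanishes on `I` and has the same syndrome, so the syndrome weight is the distance
  -- from `c + e` to `c'`.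
  have h1 : hammingNorm (H.mulVec (c + e)) = hammingNorm (c + e - c') := by
    rw [← hH.hammingNorm_mulVec (y := c + e - c') fun i hi => by
      rw [Pi.sub_apply, hv' i hi, sub_self], Matrix.mulVec_sub, hH.mulVec_eq_zero hc', sub_zero]
  have h2 : c = c' := eq_of_hammingNorm_sub_le_capability (y := c + e) hc hc' (by simpa using he)
    (h1 ▸ h)
  rw [recover_eq hI hc' hv', h2]

variable {K : Type*} [Field K] {C : Submodule (ZMod 2) (Word K)} {I : Set K}

/-- An automorphism of the punctured code of an even code extends to the code. -/
lemma act_ofSubtype_mem [Fintype K] [DecidableEq K] (heven : ∀ x ∈ C, ∑ g, x g = 0)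
    {τ : Equiv.Perm (NonzeroPos K)} (hτ : τ ∈ PAut (punctured C)) {c : Word K} (hc : c ∈ C) :
    act (Equiv.Perm.ofSubtype τ) c ∈ C := by
  have h1 : act τ (fun g => c g) ∈ (punctured C : Set (Word (NonzeroPos K))) := by
    rw [← show act τ '' (punctured C : Set (Word (NonzeroPos K))) = punctured C from hτ]
    exact ⟨_, ⟨c, hc, rfl⟩, rfl⟩
  obtain ⟨d, hd, hdc⟩ := h1
  have h2 : ∀ g : K, g ≠ 0 → act (Equiv.Perm.ofSubtype τ) c g = d g := by
    intro g hg
    have h3 : (Equiv.Perm.ofSubtype τ).symm g = (τ.symm ⟨g, hg⟩ : NonzeroPos K) := by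
      rw [Equiv.symm_apply_eq, Equiv.Perm.ofSubtype_apply_coe, Equiv.apply_symm_apply]
    have h4 := congrFun hdc ⟨g, hg⟩
    simp only [LinearMap.funLeft_apply] at h4
    rw [act, h3, h4]
    rfl
  -- Both words have symbol sum zero, so the symbol at `0` is determined by the others.
  have h0 : act (Equiv.Perm.ofSubtype τ) c 0 = d 0 := by
    have h5 : ∑ g, (act (Equiv.Perm.ofSubtype τ) c g - d g) = 0 := by
      rw [Finset.sum_sub_distrib, heven d hd, sub_zero, ← heven c hc]
      exact Equiv.sum_comp (Equiv.Perm.ofSubtype τ).symm c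
    rw [Fintype.sum_eq_single 0 fun g hg => by rw [h2 g hg, sub_self]] at h5
    exact sub_eq_zero.1 h5
  have : act (Equiv.Perm.ofSubtype τ) c = d := funext fun g => by
    by_cases hg : g = 0
    · rw [hg, h0]
    · exact h2 g hg
  rwa [this]

lemma findSome?_eq_some_of_forall {A B : Type*} {l : List A} {f : A → Option B} {b : B}
    (h : ∀ a ∈ l, f a = none ∨ f a = some b) (hex : ∃ a ∈ l, f a = some b) :
    l.findSome? f = some b := by
  induction l with
  | nil => simp at hex
  | cons a l ih =>
    rcases h a (by simp) with ha | ha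
    · rw [List.findSome?_cons, ha]
      refine ih (fun x hx => h x (by simp [hx])) ?_
      obtain ⟨x, hx, hxb⟩ := hex
      rcases List.mem_cons.1 hx with rfl | hx
      · simp [ha] at hxb
      · exact ⟨x, hx, hxb⟩
    · rw [List.findSome?_cons, ha]

lemma findSome?_eq_none_or_some {A B : Type*} {l : List A} {f : A → Option B} {b : B}
    (h : ∀ a ∈ l, f a = none ∨ f a = some b) : l.findSome? f = none ∨ l.findSome? f = some b := by
  by_cases hex : ∃ a ∈ l, f a = some b
  · exact Or.inr (findSome?_eq_some_of_forall h hex)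
  · refine Or.inl (List.findSome?_eq_none_iff.2 fun a ha => (h a ha).resolve_right fun hb => ?_)
    exact hex ⟨a, ha, hb⟩

/-- Algorithm II for a translation-invariant even code. -/
theorem algorithmII_eq_some [Fintype K] [DecidableEq K] {ρ : Type*} [Fintype ρ] [DecidableEq ρ]
    {α : K} {H : Matrix ρ K (ZMod 2)} {P : List (Equiv.Perm (NonzeroPos K))} {s : ℕ}
    (hα : ∀ g : K, g ≠ 0 → ∃ k < Fintype.card K - 1, α ^ k = g)
    (heven : ∀ x ∈ C, ∑ g, x g = 0)
    (htrans : ∀ a : K, ∀ x ∈ C, act (Equiv.addRight a) x ∈ C)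
    (hI : IsInformationSet C I) (hH : IsStandardParityCheck C I H)
    (hP : IsPDLikeSet C I s {τ | τ ∈ P}) (hs : s ≤ Fintype.card K - 1)
    {c e : Word K} (hc : c ∈ C) (hes : hammingNorm e ≤ s) (het : hammingNorm e ≤ capability C) :
    algorithmII C α I H P (c + e) = some c := by
  have hσC : ∀ σ ∈ translations α, act σ c ∈ C := by
    intro σ hσ
    rcases List.mem_cons.1 hσ with rfl | hσ
    · exact hc
    · obtain ⟨k, -, rfl⟩ := List.mem_map.1 hσ
      exact htrans _ c hc
  -- Soundness: every pair that passes the test yields `c`, so the order of the search is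
  -- irrelevant.
  have hstep : ∀ σ ∈ translations α, ∀ τ ∈ P,
      hammingNorm (H.mulVec (act (Equiv.Perm.ofSubtype τ) (act σ (c + e)))) ≤ capability C →
      act σ⁻¹ (act (Equiv.Perm.ofSubtype τ)⁻¹
        (recover C I (act (Equiv.Perm.ofSubtype τ) (act σ (c + e))))) = c := by
    intro σ hσ τ hτ h
    rw [act_add, act_add] at h ⊢
    rw [recover_eq_of_hammingNorm_mulVec_le hI hH
      (act_ofSubtype_mem heven (hP.1 hτ) (hσC σ hσ)) (by rwa [hammingNorm_act, hammingNorm_act]) h,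
      act_inv_act, act_inv_act]
  obtain ⟨σ, hσ, hσ0⟩ : ∃ σ ∈ translations α, act σ e 0 = 0 := by
    by_cases h0 : e 0 = 0
    · exact ⟨1, by simp [translations], h0⟩
    · obtain ⟨a, ha⟩ : ∃ a : K, e a = 0 := by
        by_contra hne
        push Not at hne
        have h1 : hammingNorm e = Fintype.card K := by
          unfold hammingNorm
          rw [Finset.filter_true_of_mem fun i _ => hne i, Finset.card_univ]
        have := Fintype.card_pos (α := K)
        omega
      obtain ⟨k, hk, hka⟩ := hα (-a) (by rintro h; rw [neg_eq_zero] at h; exact h0 (h ▸ ha))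
      refine ⟨Equiv.addRight (α ^ k), ?_, ?_⟩
      · exact List.mem_cons_of_mem _ (List.mem_map.2 ⟨k, List.mem_range.2 hk, rfl⟩)
      · simp [act, hka, ha]
  obtain ⟨τ, hτ, hτI⟩ : ∃ τ ∈ P, ∀ g : NonzeroPos K, act σ e g ≠ 0 → (τ g : K) ∉ I := by
    let B : Finset (NonzeroPos K) := Finset.univ.filter fun g => act σ e g ≠ 0
    have hB : B.card ≤ s := by
      rw [← Finset.card_map (Function.Embedding.subtype _)]
      refine le_trans (Finset.card_le_card ?_) ((hammingNorm_act σ e).trans_le hes)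
      intro g hg
      obtain ⟨g', hg', rfl⟩ := Finset.mem_map.1 hg
      simpa [B] using hg'
    -- The PD-like condition concerns exactly `s` positions, so a smaller error support is padded.
    obtain ⟨B', hBB', hcard⟩ := Finset.exists_superset_card_eq hB (by
      rw [Fintype.card_subtype_compl, Fintype.card_subtype_eq]; exact hs)
    obtain ⟨τ, hτ, h⟩ := hP.2 B' hcard
    exact ⟨τ, hτ, fun g hg => h g (hBB' (by simpa [B] using hg))⟩
  have hzero : ∀ i ∈ I, act (Equiv.Perm.ofSubtype τ) (act σ e) i = 0 := by
    intro i hi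
    by_contra hne
    obtain ⟨j, rfl⟩ := (Equiv.Perm.ofSubtype τ).surjective i
    have hj : act σ e j ≠ 0 := by
      rwa [act, Equiv.symm_apply_apply] at hne
    have hj0 : j ≠ 0 := by rintro rfl; exact hj hσ0
    refine hτI ⟨j, hj0⟩ hj ?_
    rwa [← Equiv.Perm.ofSubtype_apply_coe]
  have hinner : ∀ σ ∈ translations α, ∀ τ ∈ P,
      (if hammingNorm (H.mulVec (act (Equiv.Perm.ofSubtype τ) (act σ (c + e)))) ≤ capability C then
        some (act σ⁻¹ (act (Equiv.Perm.ofSubtype τ)⁻¹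
          (recover C I (act (Equiv.Perm.ofSubtype τ) (act σ (c + e)))))) else none) = none ∨
      (if hammingNorm (H.mulVec (act (Equiv.Perm.ofSubtype τ) (act σ (c + e)))) ≤ capability C then
        some (act σ⁻¹ (act (Equiv.Perm.ofSubtype τ)⁻¹
          (recover C I (act (Equiv.Perm.ofSubtype τ) (act σ (c + e)))))) else none) = some c := by
    intro σ hσ τ hτ
    split_ifs with h
    · exact Or.inr (congrArg some (hstep σ hσ τ hτ h))
    · exact Or.inl rfl
  refine findSome?_eq_some_of_forall (fun σ hσ => findSome?_eq_none_or_some (hinner σ hσ))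
    ⟨σ, hσ, findSome?_eq_some_of_forall (hinner σ hσ) ⟨τ, hτ, ?_⟩⟩
  have hlight : hammingNorm (H.mulVec (act (Equiv.Perm.ofSubtype τ) (act σ (c + e))))
      ≤ capability C := by
    rw [act_add, act_add]
    exact hH.hammingNorm_mulVec_le (act_ofSubtype_mem heven (hP.1 hτ) (hσC σ hσ))
      (by rwa [hammingNorm_act, hammingNorm_act]) hzero
  rw [if_pos hlight, hstep σ hσ τ hτ hlight]

end Algorithm

end PermDec

namespace PermDec

/-! ### Parameters and automorphisms of R(1, m) -/

section FirstOrder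

variable {K : Type*} [Field K] [Fintype K] [Algebra (ZMod 2) K]

lemma finrank_eq_of_card {m : ℕ} (hK : Fintype.card K = 2 ^ m) :
    Module.finrank (ZMod 2) K = m := by
  have := Module.card_eq_pow_finrank (K := ZMod 2) (V := K)
  rw [hK, ZMod.card] at this
  exact (Nat.pow_right_injective le_rfl this).symm

/-- Translation by some `u` with `L u = 1` flips every symbol, exchanging zeros and support. -/
lemma two_mul_hammingNorm_affine {L : K →ₗ[ZMod 2] ZMod 2} {b : ZMod 2} {x : Word K}
    (hL : L ≠ 0) (hx : ∀ g, x g = L g + b) : 2 * hammingNorm x = Fintype.card K := by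
  obtain ⟨u, hu⟩ : ∃ u, L u ≠ 0 := by
    by_contra! h
    exact hL (LinearMap.ext h)
  have hu1 : L u = 1 := by
    generalize L u = z at hu
    revert z; decide
  have key : ∀ g, x (g + u) = x g + 1 := fun g => by rw [hx, hx, map_add, hu1]; ring
  have hz : ∀ z : ZMod 2, z + 1 ≠ 0 ↔ z = 0 := by decide
  have h1 : (Finset.univ.filter fun g => ¬ x g ≠ 0).card = hammingNorm x := by
    unfold hammingNorm
    refine Finset.card_bij' (fun g _ => g + u) (fun g _ => g - u) ?_ ?_ ?_ ?_
    · intro g hg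
      simpa [key, hz] using hg
    · intro g hg
      have := key (g - u)
      rw [sub_add_cancel] at this
      simpa [this, hz] using hg
    · simp
    · simp
  have h2 := Finset.card_filter_add_card_filter_not (s := Finset.univ) (fun g => x g ≠ 0)
  rw [h1, Finset.card_univ] at h2
  have h3 : (Finset.univ.filter fun g => x g ≠ 0).card = hammingNorm x := rfl
  omega

lemma minDist_reedMuller_one {m : ℕ} (hm : 2 ≤ m) (hK : Fintype.card K = 2 ^ m) :
    minDist (reedMuller K 1 m) = 2 ^ (m - 1) := by
  have hpow : 2 ^ m = 2 * 2 ^ (m - 1) := by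
    rw [← pow_succ', Nat.sub_add_cancel (by omega)]
  refine IsLeast.csInf_eq ⟨?_, ?_⟩
  · obtain ⟨L, hL⟩ : ∃ L : K →ₗ[ZMod 2] ZMod 2, L ≠ 0 := by
      by_contra! h
      exact one_ne_zero ((Module.forall_dual_apply_eq_zero_iff (ZMod 2) (1 : K)).1 fun L => by
        simp [h L])
    have h := two_mul_hammingNorm_affine (x := fun g => L g) (b := 0) hL fun g => by simp
    refine ⟨fun g => L g, linear_mem_reedMuller hm hK L, ?_, by omega⟩
    exact fun h0 => hL (LinearMap.ext fun g => congrFun h0 g)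
  · rintro d ⟨x, hx, hx0, rfl⟩
    obtain ⟨L, b, hLb⟩ := (mem_reedMuller_one_iff hm hK).1 hx
    by_cases hL : L = 0
    · have hb : b ≠ 0 := by
        rintro rfl
        exact hx0 (funext fun g => by simp [hLb, hL])
      have : hammingNorm x = Fintype.card K := by
        unfold hammingNorm
        rw [Finset.filter_true_of_mem, Finset.card_univ]
        intro g _
        simpa [hLb, hL] using hb
      omega
    · have := two_mul_hammingNorm_affine hL hLb
      omega

lemma capability_reedMuller_one {m : ℕ} (hm : 2 ≤ m) (hK : Fintype.card K = 2 ^ m) :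
    capability (reedMuller K 1 m) = 2 ^ (m - 2) - 1 := by
  have : 2 ^ (m - 1) = 2 * 2 ^ (m - 2) := by
    rw [← pow_succ']; congr 1; omega
  rw [capability, minDist_reedMuller_one hm hK]
  omega

lemma sum_eq_zero_of_mem_reedMuller_one {m : ℕ} (hm : 2 ≤ m) {x : Word K}
    (hx : x ∈ reedMuller K 1 m) : ∑ g, x g = 0 := by
  have h4 : 2 ^ 2 ≤ 2 ^ m := Nat.pow_le_pow_right (by norm_num) hm
  have h := mem_reedMuller_one.1 hx 0 (by omega) (by simp [twoWeight]; omega)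
  simp only [pow_zero, Algebra.smul_def, mul_one, ← map_sum] at h
  exact (map_eq_zero (algebraMap (ZMod 2) K)).1 h

lemma act_addRight_mem_reedMuller {m : ℕ} (hm : 2 ≤ m) (hK : Fintype.card K = 2 ^ m) (a : K)
    {x : Word K} (hx : x ∈ reedMuller K 1 m) : act (Equiv.addRight a) x ∈ reedMuller K 1 m := by
  rw [mem_reedMuller_one_iff hm hK] at hx ⊢
  obtain ⟨L, b, h⟩ := hx
  exact ⟨L, b + L (-a), fun g => by
    simp only [act, h, Equiv.addRight_symm, Equiv.coe_addRight, map_add]; ring⟩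

/-- Multiplication by a unit, as a permutation of the nonzero positions. -/
def mulPerm (u : Kˣ) : Equiv.Perm (NonzeroPos K) :=
  (Equiv.mulLeft₀ (u : K) u.ne_zero).subtypePerm fun g => by simp

lemma act_mulPerm_mem {m : ℕ} (hm : 2 ≤ m) (hK : Fintype.card K = 2 ^ m) (u : Kˣ)
    {x : Word (NonzeroPos K)} (hx : x ∈ punctured (reedMuller K 1 m)) :
    act (mulPerm u) x ∈ punctured (reedMuller K 1 m) := by
  obtain ⟨y, hy, rfl⟩ := hx
  obtain ⟨L, b, h⟩ := (mem_reedMuller_one_iff hm hK).1 hy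
  refine ⟨fun g => y ((u⁻¹ : Kˣ) * g), (mem_reedMuller_one_iff hm hK).2
    ⟨L.comp (LinearMap.mulLeft (ZMod 2) ((u⁻¹ : Kˣ) : K)), b, fun g => h _⟩, ?_⟩
  funext g
  have : (((mulPerm u).symm g : NonzeroPos K) : K) = (u⁻¹ : Kˣ) * g := by
    obtain ⟨g', rfl⟩ := (mulPerm u).surjective g
    rw [Equiv.symm_apply_apply]
    simp [mulPerm]
  simp [act, LinearMap.funLeft_apply, this]

lemma mulPerm_mem_PAut {m : ℕ} (hm : 2 ≤ m) (hK : Fintype.card K = 2 ^ m) (u : Kˣ) :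
    mulPerm u ∈ PAut (punctured (reedMuller K 1 m)) := by
  have hinv : (mulPerm u)⁻¹ = mulPerm u⁻¹ := by
    rw [inv_eq_iff_mul_eq_one]
    ext g
    simp [mulPerm]
  exact mem_PAut_of_mapsTo (fun x hx => act_mulPerm_mem hm hK u hx)
    (fun x hx => hinv ▸ act_mulPerm_mem hm hK u⁻¹ hx)

lemma finrank_reedMuller_one {m : ℕ} (hm : 2 ≤ m) (hK : Fintype.card K = 2 ^ m) :
    Module.finrank (ZMod 2) (reedMuller K 1 m) = m + 1 := by
  let f : (Module.Dual (ZMod 2) K × ZMod 2) →ₗ[ZMod 2] Word K :=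
    { toFun := fun p g => p.1 g + p.2
      map_add' := fun p q => funext fun g => by simp; ring
      map_smul' := fun a p => funext fun g => by simp [mul_add] }
  have hinj : Function.Injective f := by
    rintro ⟨L, b⟩ ⟨L', b'⟩ h
    have hb : b = b' := by simpa [f] using congrFun h 0
    subst hb
    refine Prod.ext (LinearMap.ext fun g => ?_) rfl
    simpa [f] using congrFun h g
  have hrange : LinearMap.range f = reedMuller K 1 m := by
    ext x
    rw [mem_reedMuller_one_iff hm hK, LinearMap.mem_range]
    constructor
    · rintro ⟨⟨L, b⟩, rfl⟩
      exact ⟨L, b, fun g => rfl⟩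
    · rintro ⟨L, b, h⟩
      exact ⟨(L, b), funext fun g => (h g).symm⟩
  rw [← hrange, LinearMap.finrank_range_of_inj hinj, Module.finrank_prod,
    Subspace.dual_finrank_eq, finrank_eq_of_card hK, Module.finrank_self]

/-- The value at `0` is the constant term; the remaining values then prescribe the linear part
freely on a basis. -/
lemma isInformationSet_of_basis {m : ℕ} (hm : 2 ≤ m) (hK : Fintype.card K = 2 ^ m)
    (b : Module.Basis (Fin m) (ZMod 2) K) :
    IsInformationSet (reedMuller K 1 m) ({0} ∪ Set.range b) := by
  constructor
  · rw [finrank_reedMuller_one hm hK, Set.singleton_union, Set.ncard_insert_of_notMem,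
      ← Set.image_univ, Set.ncard_image_of_injective _ b.injective, Set.ncard_univ, Nat.card_fin]
    rintro ⟨i, hi⟩
    exact b.ne_zero i hi
  · intro v
    let z : ({0} ∪ Set.range b : Set K) := ⟨0, by simp⟩
    let w : Fin m → ({0} ∪ Set.range b : Set K) := fun i => ⟨b i, by simp⟩
    refine ⟨fun g => b.constr (ZMod 2) (fun i => v (w i) - v z) g + v z,
      (mem_reedMuller_one_iff hm hK).2 ⟨_, v z, fun g => rfl⟩, ?_⟩
    rintro ⟨g, hg⟩
    rcases hg with hg | ⟨i, rfl⟩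
    · obtain rfl : g = 0 := hg
      simp [z]
    · simp only [Module.Basis.constr_basis, sub_add_cancel]
      rfl

end FirstOrder

/-! ### Logarithms, the information set and the PD-like set -/

section PrimitiveRoot

variable {K : Type*} [Field K] {α : K} {n : ℕ}

lemma pow_val_natCast (hα : IsPrimitiveRoot α n) (k : ℕ) : α ^ (k : ZMod n).val = α ^ k := by
  rw [ZMod.val_natCast, hα.eq_orderOf, pow_mod_orderOf]

lemma pow_val_add [NeZero n] (hα : IsPrimitiveRoot α n) (i j : ZMod n) :
    α ^ (i + j).val = α ^ i.val * α ^ j.val := by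
  rw [← pow_add, ← pow_val_natCast hα (i.val + j.val), Nat.cast_add, ZMod.natCast_zmod_val,
    ZMod.natCast_zmod_val]

lemma pow_val_injective [NeZero n] (hα : IsPrimitiveRoot α n) {i j : ZMod n}
    (h : α ^ i.val = α ^ j.val) : i = j :=
  ZMod.val_injective n (hα.pow_inj (ZMod.val_lt i) (ZMod.val_lt j) h)

lemma exists_pow_eq_of_ne_zero [Fintype K] (hα : IsPrimitiveRoot α (Fintype.card K - 1)) {g : K}
    (hg : g ≠ 0) : ∃ k < Fintype.card K - 1, α ^ k = g := by
  have hn : 0 < Fintype.card K - 1 := by have := Fintype.one_lt_card (α := K); omega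
  have : NeZero (Fintype.card K - 1) := ⟨hn.ne'⟩
  exact hα.eq_pow_of_pow_eq_one (FiniteField.pow_card_sub_one_eq_one g hg)

variable {r₁ r₂ : ℕ} (φ : ZMod n ≃+ ZMod r₁ × ZMod r₂)

lemma pow_val_symm_pow [NeZero n] (hα : IsPrimitiveRoot α n) (k : ℕ) :
    (α ^ (φ.symm (1, 0)).val) ^ k = α ^ (φ.symm (k, 0)).val := by
  have h : φ.symm (k, 0) = (((φ.symm (1, 0)).val * k : ℕ) : ZMod n) := by
    rw [Nat.cast_mul, ZMod.natCast_zmod_val, mul_comm, ← nsmul_eq_mul, ← map_nsmul]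
    simp
  rw [← pow_mul, h, pow_val_natCast hα]

lemma orderOf_pow_val_symm [NeZero n] (hα : IsPrimitiveRoot α n) :
    orderOf (α ^ (φ.symm (1, 0)).val) = r₁ := by
  have key : ∀ k : ℕ, (α ^ (φ.symm (1, 0)).val) ^ k = 1 ↔ r₁ ∣ k := by
    intro k
    rw [pow_val_symm_pow φ hα, ← ZMod.natCast_eq_zero_iff]
    constructor
    · intro h
      have h0 : φ.symm (k, 0) = 0 := pow_val_injective hα (by rw [h, ZMod.val_zero, pow_zero])
      rw [map_eq_zero_iff φ.symm φ.symm.injective] at h0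
      exact congrArg Prod.fst h0
    · intro h
      rw [h, show ((0, 0) : ZMod r₁ × ZMod r₂) = 0 from rfl, map_zero, ZMod.val_zero, pow_zero]
  exact Nat.dvd_antisymm (orderOf_dvd_of_pow_eq_one ((key r₁).2 dvd_rfl))
    ((key _).1 (pow_orderOf_eq_one _))

/-- Since `2` has order `m`, the second bound in `Gam` is `m / m = 1`: `Γ` is the segment of
multiples `k • (1, 0)`, `k < m`. -/
lemma infoSet_eq {m : ℕ} [NeZero n] (hα : IsPrimitiveRoot α n) (hm : 0 < m) (hmr : m < r₁)
    (hord : orderOf (2 : ZMod r₁) = m) :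
    infoSet m α φ = {0} ∪ Set.range fun i : Fin m => (α ^ (φ.symm (1, 0)).val) ^ (i : ℕ) := by
  have : NeZero r₁ := ⟨by omega⟩
  have hdiv : m / orderOf (2 : ZMod r₁) = 1 := by rw [hord, Nat.div_self hm]
  unfold infoSet
  congr 1
  ext g
  simp only [Set.mem_ofPred_eq, Set.mem_range, Gam, hdiv, Nat.lt_one_iff, ZMod.val_eq_zero]
  constructor
  · rintro ⟨i, ⟨h1, h2⟩, rfl⟩
    refine ⟨⟨(φ i).1.val, hord ▸ h1⟩, ?_⟩
    rw [pow_val_symm_pow φ hα, ZMod.natCast_zmod_val, ← h2]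
    simp
  · rintro ⟨i, rfl⟩
    refine ⟨φ.symm ((i : ℕ), 0), ?_, pow_val_symm_pow φ hα i⟩
    rw [AddEquiv.apply_symm_apply]
    refine ⟨?_, rfl⟩
    rw [hord, ZMod.val_natCast]
    exact (Nat.mod_le _ _).trans_lt i.2

/-- In a field with `2 ^ m` elements, an element of order `r` generates the field over the prime
field when `2` has order `m` modulo `r`. -/
lemma exists_basis_pow [Fintype K] [Algebra (ZMod 2) K] {m : ℕ} (hK : Fintype.card K = 2 ^ m)
    {β : K} (hβ0 : β ≠ 0) (hβ : orderOf (2 : ZMod (orderOf β)) = m) :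
    ∃ b : Module.Basis (Fin m) (ZMod 2) K, ∀ i, b i = β ^ (i : ℕ) := by
  have hint : IsIntegral (ZMod 2) β := Algebra.IsIntegral.isIntegral β
  have hrank := finrank_eq_of_card hK
  have hle : (minpoly (ZMod 2) β).natDegree ≤ m := hrank ▸ minpoly.natDegree_le β
  have hpos := minpoly.natDegree_pos hint
  -- With `d` this degree, `β` lies in a subfield of `2 ^ d` elements, so its order divides `2 ^ d -
  -- 1`, that is, `2 ^ d = 1` modulo `orderOf β`.
  have hdvd : m ∣ (minpoly (ZMod 2) β).natDegree := by
    have hfr := IntermediateField.adjoin.finrank hint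
    have : Fintype (IntermediateField.adjoin (ZMod 2) {β}) := Fintype.ofFinite _
    have hcard := Module.card_eq_pow_finrank (K := ZMod 2)
      (V := IntermediateField.adjoin (ZMod 2) {β})
    rw [hfr, ZMod.card] at hcard
    have hpow := FiniteField.pow_card (IntermediateField.AdjoinSimple.gen (ZMod 2) β)
    rw [hcard, ← Nat.sub_add_cancel (Nat.one_le_two_pow (n := (minpoly (ZMod 2) β).natDegree)),
      pow_succ] at hpow
    have hpow' := congrArg (Subtype.val) hpow
    simp only [MulMemClass.coe_mul, SubmonoidClass.coe_pow,
      IntermediateField.AdjoinSimple.coe_gen] at hpow'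
    have h1 := orderOf_dvd_of_pow_eq_one (mul_eq_right₀ hβ0 |>.1 hpow')
    rw [← ZMod.natCast_eq_zero_iff, Nat.cast_sub Nat.one_le_two_pow] at h1
    rw [← hβ]
    exact orderOf_dvd_of_pow_eq_one (by simpa using sub_eq_zero.1 h1)
  have hdeg : (minpoly (ZMod 2) β).natDegree = m := le_antisymm hle (Nat.le_of_dvd hpos hdvd)
  have hli := linearIndependent_pow (K := ZMod 2) β
  rw [hdeg] at hli
  have : Nonempty (Fin m) := ⟨⟨0, hdeg ▸ hpos⟩⟩
  exact ⟨basisOfLinearIndependentOfCardEqFinrank hli (by rw [hrank, Fintype.card_fin]),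
    fun i => by simp⟩

/-- Few points in a product of two cyclic groups can be moved out of a short segment. -/
lemma exists_shift_notMem_segment {m l : ℕ} [NeZero r₁] [NeZero r₂] (hl : l * m < r₁)
    (F : Finset (ZMod r₁ × ZMod r₂)) (hF : F.card < r₂ * (l + 1)) :
    ∃ a : ZMod r₁ × ZMod r₂, ∀ p ∈ F, ¬ ((a + p).1.val < m ∧ (a + p).2 = 0) := by
  classical
  obtain ⟨j, -, hj⟩ := Finset.exists_card_fiber_lt_of_card_lt_mul (s := F) (t := Finset.univ)
    (f := Prod.snd) (n := l + 1) (by rwa [Finset.card_univ, ZMod.card])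
  -- The shifts that would bring a point of row `j` into the segment: at most `l * m` of them.
  let D : Finset (ZMod r₁) := (F.filter (fun p => p.2 = j) ×ˢ Finset.range m).image
    fun q => (q.2 : ZMod r₁) - q.1.1
  have hD : D.card < Fintype.card (ZMod r₁) := by
    rw [ZMod.card]
    refine lt_of_le_of_lt Finset.card_image_le ?_
    rw [Finset.card_product, Finset.card_range]
    exact lt_of_le_of_lt (Nat.mul_le_mul_right m (by omega)) hl
  obtain ⟨a, ha⟩ : ∃ a, a ∉ D := by
    by_contra! h
    rw [Finset.eq_univ_of_forall h, Finset.card_univ] at hD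
    exact lt_irrefl _ hD
  refine ⟨(a, -j), fun p hp h => ha ?_⟩
  refine Finset.mem_image.2 ⟨(p, (a + p.1).val), ?_, ?_⟩
  · refine Finset.mem_product.2 ⟨Finset.mem_filter.2 ⟨hp, ?_⟩, Finset.mem_range.2 h.1⟩
    have : -j + p.2 = 0 := h.2
    exact (neg_add_eq_zero.1 this).symm
  · simp

/-- All scalings by units serve as `P`: multiplication by `α ^ i` translates logarithms by `φ i`,
and never reaches `0`. -/
lemma exists_isPDLikeSet [Fintype K] [Algebra (ZMod 2) K] {m l s : ℕ} (hm : 2 ≤ m)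
    (hK : Fintype.card K = 2 ^ m) [NeZero n] [NeZero r₁] [NeZero r₂]
    (hn : Fintype.card K - 1 = n) (hα : IsPrimitiveRoot α n)
    (hord : orderOf (2 : ZMod r₁) = m) (hl : l * m < r₁) (hs : s < r₂ * (l + 1)) :
    ∃ P : List (Equiv.Perm (NonzeroPos K)),
      IsPDLikeSet (reedMuller K 1 m) (infoSet m α φ) s {τ | τ ∈ P} := by
  classical
  have hdiv : m / orderOf (2 : ZMod r₁) = 1 := by rw [hord, Nat.div_self (by omega)]
  refine ⟨(Finset.univ : Finset Kˣ).toList.map mulPerm, ?_, ?_⟩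
  · intro τ hτ
    obtain ⟨u, -, rfl⟩ := List.mem_map.1 hτ
    exact mulPerm_mem_PAut hm hK u
  · intro B hB
    have hlog : ∀ g : NonzeroPos K, ∃ k : ZMod n, α ^ k.val = g := by
      intro g
      obtain ⟨k, -, hk⟩ := exists_pow_eq_of_ne_zero (hn ▸ hα) g.2
      exact ⟨k, by rw [pow_val_natCast hα, hk]⟩
    choose k hk using hlog
    obtain ⟨a, ha⟩ := exists_shift_notMem_segment hl (B.image fun g => φ (k g))
      (Finset.card_image_le.trans_lt (hB ▸ hs))
    have hne : α ^ (φ.symm a).val ≠ 0 := pow_ne_zero _ (hα.ne_zero (NeZero.ne n))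
    refine ⟨mulPerm (Units.mk0 _ hne), List.mem_map.2 ⟨_, by simp, rfl⟩, fun b hb hbI => ?_⟩
    have hval : (mulPerm (Units.mk0 _ hne) b : K) = α ^ (φ.symm a + k b).val := by
      rw [pow_val_add hα, hk]
      simp [mulPerm]
    rcases hbI with hb0 | ⟨i, hi, hib⟩
    · exact (mulPerm (Units.mk0 _ hne) b).2 hb0
    · have h1 : φ.symm a + k b = i := pow_val_injective hα (hval.symm.trans hib)
      rw [← h1, map_add, AddEquiv.apply_symm_apply] at hi
      simp only [Gam, Set.mem_ofPred_eq, hord, Nat.div_self (show 0 < m by omega),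
        Nat.lt_one_iff, ZMod.val_eq_zero] at hi
      exact ha _ (Finset.mem_image_of_mem _ hb) hi

end PrimitiveRoot

/-! ### Numerical bounds -/

section Bounds

/-- The condition `m < ⌈r / l⌉` amounts to `l * m < r`, that is, `l * m ≤ r - 1`. -/
lemma isGreatest_div {m r : ℕ} (hm : 0 < m) (hmr : m < r) :
    IsGreatest {l : ℕ | 0 < l ∧ m < ⌈(r : ℚ) / (l : ℚ)⌉₊} ((r - 1) / m) := by
  have key : ∀ l : ℕ, 0 < l → (m < ⌈(r : ℚ) / (l : ℚ)⌉₊ ↔ l ≤ (r - 1) / m) := by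
    intro l hl
    rw [Nat.lt_ceil, lt_div_iff₀ (by exact_mod_cast hl), Nat.le_div_iff_mul_le hm]
    norm_cast
    rw [mul_comm]
    omega
  have hpos : 0 < (r - 1) / m := Nat.div_pos (by omega) hm
  exact ⟨⟨hpos, (key _ hpos).2 le_rfl⟩, fun l hl => (key l hl.1).1 hl.2⟩

lemma lt_of_orderOf_two_eq {m r : ℕ} (hr : 1 < r) (hm : 0 < m) (hord : orderOf (2 : ZMod r) = m) :
    m < r := by
  have : NeZero r := ⟨by omega⟩
  have : Fact (1 < r) := ⟨hr⟩
  have hu : IsUnit (2 : ZMod r) :=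
    IsUnit.of_pow_eq_one (n := m) (hord ▸ pow_orderOf_eq_one _) hm.ne'
  obtain ⟨u, hu⟩ := hu
  rw [← hu, orderOf_units] at hord
  have h1 : m ≤ Fintype.card (ZMod r)ˣ := hord ▸ orderOf_le_card_univ
  rw [ZMod.card_units_eq_totient] at h1
  exact h1.trans_lt (Nat.totient_lt r hr)

lemma error_bound_le {m r₁ r₂ : ℕ} (hm : 2 < m) (hn : 2 ^ m - 1 = r₁ * r₂)
    (hr₂ : 1 < r₂) (hmr : m < r₁)
    (hord : orderOf (2 : ZMod r₁) = m) (h4 : m ≠ 4) :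
    ((r₁ - 1) / m + 1) * r₂ - 1 ≤ 2 ^ (m - 2) - 1 := by
  have hmul : (m + 1) * r₂ ≤ r₁ * r₂ := Nat.mul_le_mul_right r₂ hmr
  rw [← hn] at hmul
  rcases le_or_gt 8 m with h8 | h8
  · refine Nat.sub_le_sub_right ?_ 1
    have hdiv : m * ((r₁ - 1) / m) ≤ r₁ - 1 := Nat.mul_div_le _ _
    have h1 : 8 * ((r₁ - 1) / m + 1) ≤ 2 * r₁ := calc
      8 * ((r₁ - 1) / m + 1) ≤ m * ((r₁ - 1) / m + 1) := Nat.mul_le_mul_right _ h8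
      _ = m * ((r₁ - 1) / m) + m := by ring
      _ ≤ 2 * r₁ := by omega
    have h2 : 8 * ((r₁ - 1) / m + 1) * r₂ ≤ 2 * r₁ * r₂ := Nat.mul_le_mul_right _ h1
    have h3 : 2 ^ m = 4 * 2 ^ (m - 2) := by
      rw [show (4 : ℕ) = 2 ^ 2 by norm_num, ← pow_add]; congr 1; omega
    rw [mul_assoc, mul_assoc, ← hn] at h2
    omega
  · interval_cases m
    · omega
    · omega
    · have : r₂ ≤ 5 := by omega
      interval_cases r₂ <;> omega
    · have : r₂ ≤ 9 := by omega
      interval_cases r₂ <;> try omega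
      -- For 63 = 7 · 9 the bound fails (17 > 15), but `2` has order 3 modulo 7, not 6.
      obtain rfl : r₁ = 7 := by omega
      have : orderOf (2 : ZMod 7) ∣ 3 := orderOf_dvd_of_pow_eq_one (by decide)
      rw [hord] at this
      norm_num at this
    · have : r₂ ≤ 15 := by omega
      interval_cases r₂ <;> omega

end Bounds

end PermDec

/-! ### The main theorem -/

theorem theorem5 {K : Type*} [Field K] [Fintype K] [DecidableEq K] [Algebra (ZMod 2) K]
    (m r₁ r₂ : ℕ) (hm : 2 < m) (hK : Fintype.card K = 2 ^ m)
    (hn : 2 ^ m - 1 = r₁ * r₂) (hcop : Nat.gcd r₁ r₂ = 1) (hr₁ : 1 < r₁) (hr₂ : 1 < r₂)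
    (hord : orderOf (2 : ZMod r₁) = m)
    (α : K) (hα : IsPrimitiveRoot α (2 ^ m - 1))
    (φ : ZMod (2 ^ m - 1) ≃+ ZMod r₁ × ZMod r₂) :
    ∃ l₀ : ℕ, IsGreatest {l : ℕ | 0 < l ∧ m < ⌈(r₁ : ℚ) / (l : ℚ)⌉₊} l₀ ∧
      ∃ s : ℕ, s = (l₀ + 1) * r₂ - 1 ∧
        -- only for `m = 4` can `s` exceed the correction capability
        (m ≠ 4 → s ≤ PermDec.capability (PermDec.reedMuller K 1 m)) ∧
        -- the data that the algorithm works with exist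
        PermDec.IsInformationSet (PermDec.reedMuller K 1 m) (PermDec.infoSet m α φ) ∧
        (∃ H : Matrix (Fin (Fintype.card K -
              Module.finrank (ZMod 2) (PermDec.reedMuller K 1 m))) K (ZMod 2),
          PermDec.IsStandardParityCheck (PermDec.reedMuller K 1 m) (PermDec.infoSet m α φ) H) ∧
        (∃ P : List (Equiv.Perm (PermDec.NonzeroPos K)),
          PermDec.IsPDLikeSet (PermDec.reedMuller K 1 m) (PermDec.infoSet m α φ) s
            {τ | τ ∈ P}) ∧
        -- whatever their choice, up to `s` errors (within the correction capability) are corrected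
        ∀ (H : Matrix (Fin (Fintype.card K -
              Module.finrank (ZMod 2) (PermDec.reedMuller K 1 m))) K (ZMod 2))
          (P : List (Equiv.Perm (PermDec.NonzeroPos K))),
          PermDec.IsStandardParityCheck (PermDec.reedMuller K 1 m) (PermDec.infoSet m α φ) H →
          PermDec.IsPDLikeSet (PermDec.reedMuller K 1 m) (PermDec.infoSet m α φ) s {τ | τ ∈ P} →
          ∀ c ∈ PermDec.reedMuller K 1 m, ∀ e : PermDec.Word K,
            hammingNorm e ≤ s →
            hammingNorm e ≤ PermDec.capability (PermDec.reedMuller K 1 m) →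
            PermDec.algorithmII (PermDec.reedMuller K 1 m) α (PermDec.infoSet m α φ) H P (c + e)
              = some c := by
  have h2 : 2 ≤ m := by omega
  have hmr := PermDec.lt_of_orderOf_two_eq hr₁ (by omega) hord
  have : NeZero (2 ^ m - 1) := ⟨by rw [hn]; positivity⟩
  have : NeZero r₁ := ⟨by omega⟩
  have : NeZero r₂ := ⟨by omega⟩
  have hKn : Fintype.card K - 1 = 2 ^ m - 1 := by rw [hK]
  have hdiv : (r₁ - 1) / m * m ≤ r₁ - 1 := Nat.div_mul_le_self _ _
  have hI : PermDec.IsInformationSet (PermDec.reedMuller K 1 m) (PermDec.infoSet m α φ) := by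
    obtain ⟨b, hb⟩ := PermDec.exists_basis_pow hK (β := α ^ (φ.symm (1, 0)).val)
      (pow_ne_zero _ (hα.ne_zero (NeZero.ne _)))
      (by rw [PermDec.orderOf_pow_val_symm φ hα, hord])
    rw [PermDec.infoSet_eq φ hα (by omega) hmr hord, ← funext hb]
    exact PermDec.isInformationSet_of_basis h2 hK b
  have hs : ((r₁ - 1) / m + 1) * r₂ - 1 < r₂ * ((r₁ - 1) / m + 1) := by
    rw [mul_comm r₂]
    exact Nat.sub_lt (by positivity) one_pos
  refine ⟨(r₁ - 1) / m, PermDec.isGreatest_div (by omega) hmr, _, rfl, fun h4 => ?_, hI,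
    PermDec.exists_isStandardParityCheck hI,
    PermDec.exists_isPDLikeSet φ h2 hK hKn hα hord (by omega) hs, ?_⟩
  · rw [PermDec.capability_reedMuller_one h2 hK]
    exact PermDec.error_bound_le hm hn hr₂ hmr hord h4
  · intro H P hH hP c hc e hes het
    refine PermDec.algorithmII_eq_some (fun g hg => PermDec.exists_pow_eq_of_ne_zero (hKn ▸ hα) hg)
      (fun x hx => PermDec.sum_eq_zero_of_mem_reedMuller_one h2 hx)
      (fun a x hx => PermDec.act_addRight_mem_reedMuller h2 hK a hx) hI hH hP ?_ hc hes het
    rw [hKn, hn]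
    have hlt : (r₁ - 1) / m < r₁ := (Nat.div_le_self _ _).trans_lt (by omega)
    exact (Nat.sub_le _ _).trans (Nat.mul_le_mul_right r₂ hlt)
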